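/- Let $X$ be an order unit space with order unit $e$: a real vector space partially ordered by a proper convex cone $X^+$, with an element $e\in X^+$ such that for every $x\in X$ there is $\lambda>0$ with $-\lambda e\le x\le\lambda e$, such that $\|x\|_e:=\inf\{\lambda>0 : -\lambda e\le x\le\lambda e\}$ is a norm on $X$, $X$ is complete in this norm, and $X^+$ is closed. Let $\|\cdot\|_e$ also denote the dual norm on $X^*$, and let $X^{*+}=\{\varphi\in X^* : \langle\varphi,x\rangle\ge 0 \text{ for all } x\in X^+\}$. Let $(\mathcal T(t))_{t\ge0}$ be a $C_0$ semigroup of bounded operators on $X$ which is positive, i.e. $\mathcal T(t)X^+\subseteq X^+$ for all $t\ge 0$. Let $\mathcal A$ be its generator, $\mathcal A x=\lim_{t\to0+}\frac1t(\mathcal T(t)x-x)$, with domain $\mathcal D_{\mathcal A}$ the set of all $x$ for which the limit exists. Let $z\in X^+$ be an $L^1$ $\|\cdot\|_e$-detector, i.e. for every $\varphi\in X^{*+}$, $$\int_0^\infty\langle\varphi,\mathcal T(t)z\rangle\,dt<\infty\ \Longrightarrow\ \int_0^\infty\|\mathcal T^*(t)\varphi\|_e\,dt<\infty .$$ Then the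 following conditions are equivalent: (i) the equation $\mathcal A x=-z$ has a positive solution $x\in\mathcal D_{\mathcal A}\cap X^+$; (ii) $\mathcal T(t)$ is weakly $L^1$ stable on $X^+$, i.e. $\int_0^\infty\langle\varphi,\mathcal T(t)x\rangle\,dt<\infty$ for all $\varphi\in X^{*+}$ and $x\in X^+$; (iii) $\mathcal T(t)$ is exponentially stable, i.e. there are $M,\varepsilon>0$ with $\|\mathcal T(t)\|\le Me^{-\varepsilon t}$ for all $t\ge0$; (iv) $\mathcal A$ has a bounded inverse $\mathcal A^{-1}$ defined on all of $X$, and $-\mathcal A^{-1}\ge0$, i.e. $-\mathcal A^{-1}X^+\subseteq X^+$. -/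

import Mathlib

open Filter Topology MeasureTheory Set

namespace PositiveSemigroup

section Order

variable {X : Type*} [NormedAddCommGroup X] [NormedSpace ℝ X] [PartialOrder X]

/-- `e` is an order unit: `e ≥ 0` and every `x` lies in some order interval `[-l e, l e]`. -/
def IsOrderUnit (e : X) : Prop :=
  0 ≤ e ∧ ∀ x : X, ∃ l : ℝ, 0 < l ∧ -(l • e) ≤ x ∧ x ≤ l • e

/-- The order unit norm `‖x‖_e = inf {l > 0 | -l e ≤ x ≤ l e}`. -/
noncomputable def orderUnitNorm (e x : X) : ℝ :=
  sInf {l : ℝ | 0 < l ∧ -(l • e) ≤ x ∧ x ≤ l • e}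

/-- The ordered normed space `X` is an order unit space with order unit `e`: the norm of `X` is
the order unit norm of `e`, `X` is complete in it, and the positive cone is closed. -/
structure IsOrderUnitSpace (e : X) : Prop where
  isOrderUnit : IsOrderUnit e
  norm_eq : ∀ x : X, ‖x‖ = orderUnitNorm e x
  complete : CompleteSpace X
  isClosed_cone : IsClosed {x : X | 0 ≤ x}

/-- Membership in the dual cone: `φ ≥ 0` on the positive cone. -/
def IsPositiveFunctional (φ : X →L[ℝ] ℝ) : Prop :=
  ∀ x : X, 0 ≤ x → 0 ≤ φ x

end Order

section Semigroup

variable {X : Type*} [NormedAddCommGroup X] [NormedSpace ℝ X]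

/-- `(T t)_{t ≥ 0}` is a `C₀` semigroup of bounded operators; values at `t < 0` are irrelevant. -/
structure IsC0Semigroup (T : ℝ → X →L[ℝ] X) : Prop where
  map_zero : T 0 = ContinuousLinearMap.id ℝ X
  map_add : ∀ s t : ℝ, 0 ≤ s → 0 ≤ t → T (s + t) = (T s).comp (T t)
  continuousOn : ∀ x : X, ContinuousOn (fun t => T t x) (Ici 0)

/-- `y = lim_{t → 0+} (T t x - x) / t`. -/
def HasGeneratorValue (T : ℝ → X →L[ℝ] X) (x y : X) : Prop :=
  Tendsto (fun t : ℝ => t⁻¹ • (T t x - x)) (𝓝[>] 0) (𝓝 y)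

theorem HasGeneratorValue.unique {T : ℝ → X →L[ℝ] X} {x y y' : X}
    (h : HasGeneratorValue T x y) (h' : HasGeneratorValue T x y') : y = y' :=
  tendsto_nhds_unique h h'

theorem HasGeneratorValue.zero (T : ℝ → X →L[ℝ] X) : HasGeneratorValue T 0 0 := by
  simp [HasGeneratorValue]

theorem HasGeneratorValue.add {T : ℝ → X →L[ℝ] X} {x y x' y' : X}
    (h : HasGeneratorValue T x y) (h' : HasGeneratorValue T x' y') :
    HasGeneratorValue T (x + x') (y + y') := by
  refine (Tendsto.add h h').congr fun t => ?_
  rw [← smul_add, (T t).map_add]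
  congr 1
  abel

theorem HasGeneratorValue.smul {T : ℝ → X →L[ℝ] X} {x y : X} (c : ℝ)
    (h : HasGeneratorValue T x y) : HasGeneratorValue T (c • x) (c • y) := by
  refine (Tendsto.const_smul h c).congr fun t => ?_
  rw [smul_comm, (T t).map_smul, smul_sub]

/-- The infinitesimal generator `A x = lim_{t → 0+} (T t x - x) / t`, as an unbounded operator
whose domain consists of all `x` for which the limit exists in norm. -/
noncomputable def generator (T : ℝ → X →L[ℝ] X) : X →ₗ.[ℝ] X where
  domain :=
    { carrier := {x | ∃ y, HasGeneratorValue T x y}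
      zero_mem' := ⟨0, HasGeneratorValue.zero T⟩
      add_mem' := fun ⟨y, h⟩ ⟨y', h'⟩ => ⟨y + y', h.add h'⟩
      smul_mem' := fun c _ ⟨y, h⟩ => ⟨c • y, h.smul c⟩ }
  toFun :=
    { toFun := fun x => Classical.choose x.2
      map_add' := fun x x' => (Classical.choose_spec (x + x').2).unique
        ((Classical.choose_spec x.2).add (Classical.choose_spec x'.2))
      map_smul' := fun c x => (Classical.choose_spec (c • x).2).unique
        ((Classical.choose_spec x.2).smul c) }

theorem hasGeneratorValue_generator (T : ℝ → X →L[ℝ] X) (x : (generator T).domain) :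
    HasGeneratorValue T (x : X) (generator T x) :=
  Classical.choose_spec x.2

/-- Exponential stability: `‖T t‖ ≤ M exp (-ε t)` for all `t ≥ 0`, with some `M, ε > 0`. -/
def ExponentiallyStable (T : ℝ → X →L[ℝ] X) : Prop :=
  ∃ M ε : ℝ, 0 < M ∧ 0 < ε ∧ ∀ t : ℝ, 0 ≤ t → ‖T t‖ ≤ M * Real.exp (-(ε * t))

/-- The bounded operator `R` on `X` is the inverse of the unbounded operator `A`. -/
def IsBoundedInverse (A : X →ₗ.[ℝ] X) (R : X →L[ℝ] X) : Prop :=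
  (∀ y : X, ∃ h : R y ∈ A.domain, A ⟨R y, h⟩ = y) ∧ ∀ x : A.domain, R (A x) = (x : X)

end Semigroup

section PositiveSemigroup

variable {X : Type*} [NormedAddCommGroup X] [NormedSpace ℝ X] [PartialOrder X]

/-- Each `T t`, `t ≥ 0`, maps the positive cone into itself. -/
def IsPositiveSemigroup (T : ℝ → X →L[ℝ] X) : Prop :=
  ∀ t : ℝ, 0 ≤ t → ∀ x : X, 0 ≤ x → 0 ≤ T t x

/-- Weak `L¹` stability on the positive cone: `∫₀^∞ ⟨φ, T t x⟩ dt < ∞` for all `φ, x ≥ 0`. -/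
def WeaklyL1StableOnCone (T : ℝ → X →L[ℝ] X) : Prop :=
  ∀ φ : X →L[ℝ] ℝ, IsPositiveFunctional φ → ∀ x : X, 0 ≤ x →
    ∫⁻ t in Ici (0 : ℝ), ENNReal.ofReal (φ (T t x)) < ⊤

/-- `z ≥ 0` is an `L¹` norm-detector: for each `φ ≥ 0` in the dual, `∫₀^∞ ⟨φ, T t z⟩ dt < ∞` implies
`∫₀^∞ ‖T*(t) φ‖ dt < ∞`, where `T*(t) φ = φ ∘ T t` and the norm is the dual norm. -/
def IsL1NormDetector (T : ℝ → X →L[ℝ] X) (z : X) : Prop :=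
  0 ≤ z ∧ ∀ φ : X →L[ℝ] ℝ, IsPositiveFunctional φ →
    ∫⁻ t in Ici (0 : ℝ), ENNReal.ofReal (φ (T t z)) < ⊤ →
      ∫⁻ t in Ici (0 : ℝ), ENNReal.ofReal ‖φ.comp (T t)‖ < ⊤

end PositiveSemigroup

end PositiveSemigroup

/-!
Write `S_b = ∫₀^b T s ds`. If `A x = -z` with `x ≥ 0`, then `S_b z = x - T b x ≤ x`, so the detector
hypothesis applies to every positive functional and yields weak stability.

Under weak stability every positive functional is bounded on `{S_b e}`. Baire's theorem on the dual
cone makes this bound uniform, and separation from the closed cone turns it into `S_b e ≤ C e`.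
Averaging `T t x = T s (T (t - s) x)` over `s` twice gives first `T (t + 1) e ≤ K C e`, where
`T s e ≤ K e` on `[0, 1]`, and then `t T (t + 1) e ≤ K C² e`. Since `‖T t‖` is the least `c ≥ 0`
with `T t e ≤ c e`, it drops below `1`, which forces exponential decay. Finally, exponential
stability gives `-A⁻¹ = ∫₀^∞ T t dt ≥ 0`, and `x = -A⁻¹ z` closes the cycle.
-/

namespace PositiveSemigroup

section Order

variable {X Y : Type*} [NormedAddCommGroup X] [NormedSpace ℝ X] [PartialOrder X]
  [NormedAddCommGroup Y] [NormedSpace ℝ Y] [PartialOrder Y]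

theorem isClosed_setOf_isPositiveFunctional :
    IsClosed {φ : X →L[ℝ] ℝ | IsPositiveFunctional φ} := by
  simp only [IsPositiveFunctional, ofPred_forall]
  exact isClosed_iInter fun x => isClosed_iInter fun _ =>
    isClosed_Ici.preimage (ContinuousLinearMap.apply ℝ ℝ x).continuous

-- Banach–Steinhaus would need boundedness of `φ '' s` for all `φ`, not only the positive ones; the
-- Baire argument is run on the dual cone instead, which is complete because it is closed.
theorem exists_forall_apply_le_of_norm_sub_le {s : Set X}
    (hbdd : ∀ φ : X →L[ℝ] ℝ, IsPositiveFunctional φ → BddAbove (φ '' s)) :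
    ∃ (φ₀ : X →L[ℝ] ℝ) (r c : ℝ), IsPositiveFunctional φ₀ ∧ 0 < r ∧ 0 ≤ c ∧
      ∀ φ : X →L[ℝ] ℝ, IsPositiveFunctional φ → ‖φ - φ₀‖ ≤ r → ∀ x ∈ s, φ x ≤ c := by
  let P := {φ : X →L[ℝ] ℝ | IsPositiveFunctional φ}
  have : CompleteSpace P := isClosed_setOf_isPositiveFunctional.completeSpace_coe
  have : Nonempty P := ⟨0, fun _ _ => le_rfl⟩
  let F : ℕ → Set P := fun n => {φ | ∀ x ∈ s, φ.1 x ≤ n}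
  have hF_closed : ∀ n, IsClosed (F n) := fun n => by
    simp only [F, ofPred_forall]
    exact isClosed_iInter fun x => isClosed_iInter fun _ => isClosed_Iic.preimage
      ((ContinuousLinearMap.apply ℝ ℝ x).continuous.comp continuous_subtype_val)
  have hF_cover : ⋃ n, F n = univ := eq_univ_of_forall fun φ => by
    obtain ⟨c, hc⟩ := hbdd φ.1 φ.2
    obtain ⟨n, hn⟩ := exists_nat_ge c
    exact mem_iUnion.2 ⟨n, fun x hx => (hc (mem_image_of_mem _ hx)).trans hn⟩
  obtain ⟨n, φ₀, hφ₀⟩ := nonempty_interior_of_iUnion_of_closed hF_closed hF_cover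
  obtain ⟨r, hr, hball⟩ :=
    Metric.nhds_basis_closedBall.mem_iff.1 (mem_interior_iff_mem_nhds.1 hφ₀)
  refine ⟨φ₀, r, n, φ₀.2, hr, n.cast_nonneg, fun φ hφ hφr => ?_⟩
  exact hball (show (⟨φ, hφ⟩ : P) ∈ Metric.closedBall φ₀ r from
    mem_closedBall_iff_norm.2 hφr)

theorem exists_forall_apply_le_mul_norm {s : Set X} (hs : ∀ x ∈ s, 0 ≤ x)
    (hbdd : ∀ φ : X →L[ℝ] ℝ, IsPositiveFunctional φ → BddAbove (φ '' s)) :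
    ∃ C : ℝ, 0 ≤ C ∧
      ∀ φ : X →L[ℝ] ℝ, IsPositiveFunctional φ → ∀ x ∈ s, φ x ≤ C * ‖φ‖ := by
  obtain ⟨φ₀, r, c, hφ₀, hr, hc, hball⟩ := exists_forall_apply_le_of_norm_sub_le hbdd
  refine ⟨c / r, by positivity, fun φ hφ x hx => ?_⟩
  rcases eq_or_ne φ 0 with rfl | hφ_ne
  · simp
  have hφ_norm : 0 < ‖φ‖ := norm_pos_iff.2 hφ_ne
  have hψ : IsPositiveFunctional (φ₀ + (r / ‖φ‖) • φ) := fun y hy =>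
    add_nonneg (hφ₀ y hy) (mul_nonneg (by positivity) (hφ y hy))
  have hψ_norm : ‖φ₀ + (r / ‖φ‖) • φ - φ₀‖ = r := by
    rw [add_sub_cancel_left, norm_smul, Real.norm_of_nonneg (by positivity),
      div_mul_cancel₀ _ hφ_norm.ne']
  have hψ_le : φ₀ x + r / ‖φ‖ * φ x ≤ c := hball _ hψ hψ_norm.le x hx
  have hφ_le : r / ‖φ‖ * φ x ≤ c := by linarith [hφ₀ x (hs x hx)]
  calc φ x = r / ‖φ‖ * φ x * (‖φ‖ / r) := by field_simp
    _ ≤ c * (‖φ‖ / r) := by gcongr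
    _ = c / r * ‖φ‖ := by ring

variable [IsOrderedAddMonoid X]

theorem IsPositiveFunctional.monotone {φ : X →L[ℝ] ℝ} (hφ : IsPositiveFunctional φ) :
    Monotone φ := fun x y hxy => by
  simpa only [map_sub, sub_nonneg] using hφ _ (sub_nonneg.2 hxy)

theorem IsOrderUnitSpace.orderClosedTopology {e : X} (hX : IsOrderUnitSpace e) :
    OrderClosedTopology X where
  isClosed_le' := by
    simpa [preimage, sub_nonneg] using
      hX.isClosed_cone.preimage (continuous_snd.sub continuous_fst : Continuous
        fun p : X × X => p.2 - p.1)

variable [IsOrderedModule ℝ X]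

theorem le_of_forall_isPositiveFunctional_apply_le [OrderClosedTopology X] {x y : X}
    (h : ∀ φ : X →L[ℝ] ℝ, IsPositiveFunctional φ → φ x ≤ φ y) : x ≤ y := by
  by_contra hxy
  obtain ⟨φ, hφ, hneg⟩ := (ProperCone.positive ℝ X).hyperplane_separation_point
    (x₀ := y - x) (by simpa only [ProperCone.mem_positive, sub_nonneg] using hxy)
  rw [map_sub, sub_neg] at hneg
  exact (h φ hφ).not_gt hneg

namespace IsOrderUnitSpace

variable {e : X} (hX : IsOrderUnitSpace e)
include hX

theorem neg_smul_le_and_le_smul_of_norm_lt {x : X} {c : ℝ} (hc : ‖x‖ < c) :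
    -(c • e) ≤ x ∧ x ≤ c • e := by
  rw [hX.norm_eq, orderUnitNorm] at hc
  obtain ⟨l, ⟨-, hl_neg, hl⟩, hlc⟩ := exists_lt_of_csInf_lt (hX.isOrderUnit.2 x) hc
  have hle : l • e ≤ c • e := smul_le_smul_of_nonneg_right hlc.le hX.isOrderUnit.1
  exact ⟨(neg_le_neg hle).trans hl_neg, hl.trans hle⟩

theorem norm_le_of_neg_smul_le_of_le_smul {x : X} {c : ℝ} (hc : 0 ≤ c) (hneg : -(c • e) ≤ x)
    (hle : x ≤ c • e) : ‖x‖ ≤ c := by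
  refine le_of_forall_gt_imp_ge_of_dense fun d hd => ?_
  have hcd : c • e ≤ d • e := smul_le_smul_of_nonneg_right hd.le hX.isOrderUnit.1
  rw [hX.norm_eq, orderUnitNorm]
  exact csInf_le ⟨0, fun l hl => hl.1.le⟩
    ⟨hc.trans_lt hd, (neg_le_neg hcd).trans hneg, hle.trans hcd⟩

theorem norm_le_iff {x : X} {c : ℝ} (hc : 0 ≤ c) : ‖x‖ ≤ c ↔ -(c • e) ≤ x ∧ x ≤ c • e := by
  refine ⟨fun h => ?_, fun h => hX.norm_le_of_neg_smul_le_of_le_smul hc h.1 h.2⟩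
  have := hX.orderClosedTopology
  have hlim : Tendsto (fun d : ℝ => d • e) (𝓝[>] c) (𝓝 (c • e)) :=
    (tendsto_id.smul_const e).mono_left nhdsWithin_le_nhds
  have hbound : ∀ᶠ d in 𝓝[>] c, -(d • e) ≤ x ∧ x ≤ d • e := by
    filter_upwards [self_mem_nhdsWithin] with d hd
    exact hX.neg_smul_le_and_le_smul_of_norm_lt (h.trans_lt hd)
  exact ⟨le_of_tendsto hlim.neg (hbound.mono fun _ => And.left),
    ge_of_tendsto hlim (hbound.mono fun _ => And.right)⟩

theorem le_smul_of_norm_le {x : X} {c : ℝ} (h : ‖x‖ ≤ c) : x ≤ c • e :=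
  ((hX.norm_le_iff ((norm_nonneg x).trans h)).1 h).2

theorem norm_le_apply_of_isPositiveFunctional {φ : X →L[ℝ] ℝ} (hφ : IsPositiveFunctional φ) :
    ‖φ‖ ≤ φ e := by
  refine φ.opNorm_le_bound (hφ e hX.isOrderUnit.1) fun x => ?_
  obtain ⟨hneg, hle⟩ := (hX.norm_le_iff (norm_nonneg x)).1 le_rfl
  have hφ_neg := hφ.monotone hneg
  have hφ_le := hφ.monotone hle
  rw [map_neg, map_smul, smul_eq_mul, mul_comm] at hφ_neg
  rw [map_smul, smul_eq_mul, mul_comm] at hφ_le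
  exact abs_le.2 ⟨hφ_neg, hφ_le⟩

theorem opNorm_le_of_apply_le [IsOrderedAddMonoid Y] [IsOrderedModule ℝ Y] {u : Y}
    (hY : IsOrderUnitSpace u) {S : X →L[ℝ] Y} (hS : Monotone S) {c : ℝ} (hc : 0 ≤ c)
    (hSe : S e ≤ c • u) : ‖S‖ ≤ c := by
  refine S.opNorm_le_bound hc fun x => ?_
  obtain ⟨hneg, hle⟩ := (hX.norm_le_iff (norm_nonneg x)).1 le_rfl
  have hSx : S (‖x‖ • e) ≤ (c * ‖x‖) • u := by
    rw [map_smul, mul_comm, mul_smul]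
    exact smul_le_smul_of_nonneg_left hSe (norm_nonneg x)
  refine (hY.norm_le_iff (by positivity)).2 ⟨(neg_le_neg hSx).trans ?_, (hS hle).trans hSx⟩
  simpa only [map_neg] using hS hneg

theorem bddAbove_of_forall_bddAbove_image {s : Set X} (hs : ∀ x ∈ s, 0 ≤ x)
    (hbdd : ∀ φ : X →L[ℝ] ℝ, IsPositiveFunctional φ → BddAbove (φ '' s)) : BddAbove s := by
  have := hX.orderClosedTopology
  obtain ⟨C, hC, hCs⟩ := exists_forall_apply_le_mul_norm hs hbdd
  refine ⟨C • e, fun x hx => le_of_forall_isPositiveFunctional_apply_le fun φ hφ => ?_⟩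
  calc φ x ≤ C * ‖φ‖ := hCs φ hφ x hx
    _ ≤ C * φ e := by gcongr; exact hX.norm_le_apply_of_isPositiveFunctional hφ
    _ = φ (C • e) := by rw [map_smul, smul_eq_mul]

end IsOrderUnitSpace

end Order

theorem setLIntegral_ofReal_lt_top_iff_bddAbove_integral {f : ℝ → ℝ} {a : ℝ}
    (hf : LocallyIntegrableOn f (Ici a)) (hf_nonneg : ∀ t ∈ Ici a, 0 ≤ f t) :
    ∫⁻ t in Ici a, ENNReal.ofReal (f t) < ⊤ ↔
      BddAbove ((fun b => ∫ t in a..b, f t) '' Ici a) := by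
  have hf_ae : 0 ≤ᵐ[volume.restrict (Ici a)] f :=
    (ae_restrict_mem measurableSet_Ici).mono hf_nonneg
  rw [lt_top_iff_ne_top, lintegral_ofReal_ne_top_iff_integrable hf.aestronglyMeasurable hf_ae]
  constructor
  · intro hint
    refine ⟨∫ t in Ici a, f t, forall_mem_image.2 fun b hb => ?_⟩
    rw [intervalIntegral.integral_of_le hb]
    exact setIntegral_mono_set hint hf_ae
      (Ioc_subset_Ioi_self.trans Ioi_subset_Ici_self).eventuallyLE
  · rintro ⟨M, hM⟩
    rw [← IntegrableOn, integrableOn_Ici_iff_integrableOn_Ioi]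
    refine integrableOn_Ioi_of_intervalIntegral_norm_bounded M a (b := fun b : ℝ => b)
      (fun b => (hf.integrableOn_compact_subset Icc_subset_Ici_self isCompact_Icc).mono_set
        Ioc_subset_Icc_self) tendsto_id ?_
    filter_upwards [eventually_ge_atTop a] with b hb
    have hnorm : ∫ t in a..b, ‖f t‖ = ∫ t in a..b, f t :=
      intervalIntegral.integral_congr fun t ht =>
        Real.norm_of_nonneg (hf_nonneg t (uIcc_of_le hb ▸ ht).1)
    exact hnorm.trans_le (hM (mem_image_of_mem _ hb))

section Semigroup

variable {X : Type*} [NormedAddCommGroup X] [NormedSpace ℝ X] {T : ℝ → X →L[ℝ] X}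

theorem setLIntegral_functional_orbit_lt_top {φ : X →L[ℝ] ℝ}
    (hφ : ∫⁻ t in Ici (0 : ℝ), ENNReal.ofReal ‖φ.comp (T t)‖ < ⊤) (x : X) :
    ∫⁻ t in Ici (0 : ℝ), ENNReal.ofReal (φ (T t x)) < ⊤ := calc
  ∫⁻ t in Ici (0 : ℝ), ENNReal.ofReal (φ (T t x))
      ≤ ∫⁻ t in Ici (0 : ℝ), ENNReal.ofReal ‖φ.comp (T t)‖ * ENNReal.ofReal ‖x‖ := by
        refine lintegral_mono fun t => ?_
        rw [← ENNReal.ofReal_mul (norm_nonneg _)]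
        exact ENNReal.ofReal_le_ofReal ((le_abs_self _).trans ((φ.comp (T t)).le_opNorm x))
  _ = (∫⁻ t in Ici (0 : ℝ), ENNReal.ofReal ‖φ.comp (T t)‖) * ENNReal.ofReal ‖x‖ :=
        lintegral_mul_const' _ _ ENNReal.ofReal_ne_top
  _ < ⊤ := ENNReal.mul_lt_top hφ ENNReal.ofReal_lt_top

namespace IsC0Semigroup

variable (hT : IsC0Semigroup T)
include hT

theorem map_add_apply {s t : ℝ} (hs : 0 ≤ s) (ht : 0 ≤ t) (x : X) :
    T (s + t) x = T s (T t x) := by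
  rw [hT.map_add s t hs ht, ContinuousLinearMap.comp_apply]

theorem intervalIntegrable_orbit (x : X) {a b : ℝ} (ha : 0 ≤ a) (hab : a ≤ b) :
    IntervalIntegrable (fun t => T t x) volume a b :=
  ((hT.continuousOn x).mono fun _ ht => ha.trans ht.1).intervalIntegrable_of_Icc hab

theorem exists_opNorm_le_on_Icc [CompleteSpace X] (b : ℝ) :
    ∃ K : ℝ, ∀ t ∈ Icc 0 b, ‖T t‖ ≤ K := by
  obtain ⟨K, hK⟩ := banach_steinhaus (g := fun t : Icc 0 b => T t) fun x =>
    let ⟨C, hC⟩ := isCompact_Icc.exists_bound_of_continuousOn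
      ((hT.continuousOn x).mono Icc_subset_Ici_self)
    ⟨C, fun t => hC t t.2⟩
  exact ⟨K, fun t ht => hK ⟨t, ht⟩⟩

theorem opNorm_nat_mul_le {t : ℝ} (ht : 0 ≤ t) (n : ℕ) : ‖T (n * t)‖ ≤ ‖T t‖ ^ n := by
  induction n with
  | zero => simpa [hT.map_zero] using ContinuousLinearMap.norm_id_le
  | succ n ih =>
    have hsplit : ((n + 1 : ℕ) : ℝ) * t = n * t + t := by push_cast; ring
    rw [hsplit, hT.map_add _ _ (by positivity) ht, pow_succ]
    exact (ContinuousLinearMap.opNorm_comp_le _ _).trans (by gcongr)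

theorem exponentiallyStable_of_opNorm_lt_one [CompleteSpace X] {t₀ : ℝ} (ht₀ : 0 < t₀)
    (hlt : ‖T t₀‖ < 1) : ExponentiallyStable T := by
  obtain ⟨q, hq, hq₁⟩ := exists_between hlt
  have hq₀ : 0 < q := (norm_nonneg _).trans_lt hq
  obtain ⟨K, hK⟩ := hT.exists_opNorm_le_on_Icc t₀
  have hK₀ : 0 ≤ K := (norm_nonneg _).trans (hK 0 ⟨le_rfl, ht₀.le⟩)
  refine ⟨(K + 1) / q, -Real.log q / t₀, by positivity,
    div_pos (neg_pos.2 (Real.log_neg hq₀ hq₁)) ht₀, fun t ht => ?_⟩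
  set n := ⌊t / t₀⌋₊
  have hn_le : n * t₀ ≤ t := (le_div_iff₀ ht₀).1 (Nat.floor_le (by positivity))
  have hn_lt : t / t₀ - 1 ≤ n := (sub_lt_iff_lt_add.2 (Nat.lt_floor_add_one _)).le
  have hrem : t - n * t₀ ∈ Icc 0 t₀ := ⟨sub_nonneg.2 hn_le, by
    rw [div_sub_one ht₀.ne', div_le_iff₀ ht₀] at hn_lt; linarith⟩
  have hq_pow : q ^ n ≤ q⁻¹ * Real.exp (-(-Real.log q / t₀ * t)) := calc
    q ^ n = q ^ (n : ℝ) := (Real.rpow_natCast q n).symm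
    _ ≤ q ^ (t / t₀ - 1) := Real.rpow_le_rpow_of_exponent_ge hq₀ hq₁.le hn_lt
    _ = q⁻¹ * Real.exp (-(-Real.log q / t₀ * t)) := by
      rw [Real.rpow_sub_one hq₀.ne', Real.rpow_def_of_pos hq₀, div_eq_inv_mul]
      ring_nf
  calc ‖T t‖ = ‖(T (n * t₀)).comp (T (t - n * t₀))‖ := by
        rw [← hT.map_add _ _ (by positivity) hrem.1, add_sub_cancel]
    _ ≤ ‖T (n * t₀)‖ * ‖T (t - n * t₀)‖ := ContinuousLinearMap.opNorm_comp_le _ _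
    _ ≤ q ^ n * (K + 1) := by
      gcongr
      · exact (hT.opNorm_nat_mul_le ht₀.le n).trans (by gcongr)
      · exact (hK _ hrem).trans (by linarith)
    _ ≤ q⁻¹ * Real.exp (-(-Real.log q / t₀ * t)) * (K + 1) := by gcongr
    _ = (K + 1) / q * Real.exp (-(-Real.log q / t₀ * t)) := by ring

theorem hasDerivWithinAt_orbit {x y : X} (hxy : HasGeneratorValue T x y) {s : ℝ} (hs : 0 ≤ s) :
    HasDerivWithinAt (fun t => T t x) (T s y) (Ioi s) s := by
  rw [hasDerivWithinAt_iff_tendsto_slope' self_notMem_Ioi]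
  have hshift : Tendsto (fun u : ℝ => u - s) (𝓝[>] s) (𝓝[>] 0) := by
    have hmaps : MapsTo (fun u : ℝ => u - s) (Ioi s) (Ioi 0) := fun u hu => by
      simpa only [mem_Ioi, sub_pos] using hu
    simpa only [sub_self] using
      (continuous_sub_right s).continuousWithinAt.tendsto_nhdsWithin (x := s) hmaps
  refine (((T s).continuous.tendsto y).comp (hxy.comp hshift)).congr' ?_
  filter_upwards [self_mem_nhdsWithin] with u hu
  have hsu : 0 ≤ u - s := (sub_pos.2 hu).le
  simp only [Function.comp_apply, map_smul, map_sub, slope_def_module]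
  rw [← hT.map_add_apply hs hsu, add_sub_cancel]

theorem integral_orbit_generatorValue [CompleteSpace X] {x y : X}
    (hxy : HasGeneratorValue T x y) {t : ℝ} (ht : 0 ≤ t) :
    ∫ s in 0..t, T s y = T t x - x := by
  rw [intervalIntegral.integral_eq_sub_of_hasDeriv_right_of_le ht
    ((hT.continuousOn x).mono Icc_subset_Ici_self)
    (fun s hs => hT.hasDerivWithinAt_orbit hxy hs.1.le)
    (hT.intervalIntegrable_orbit y le_rfl ht), hT.map_zero, ContinuousLinearMap.id_apply]

theorem apply_integral_Ioi_orbit [CompleteSpace X] {x : X}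
    (hint : IntegrableOn (fun t => T t x) (Ioi 0)) {h : ℝ} (hh : 0 ≤ h) :
    T h (∫ t in Ioi 0, T t x) = ∫ t in Ioi h, T t x := by
  rw [← (T h).integral_comp_comm hint,
    ← (measurePreserving_add_right volume h).setIntegral_preimage_emb
      (measurableEmbedding_addRight h) _ (Ioi h), preimage_add_const_Ioi, sub_self]
  refine setIntegral_congr_fun measurableSet_Ioi fun t ht => ?_
  rw [← hT.map_add_apply hh (le_of_lt ht), add_comm]

theorem hasGeneratorValue_integral_Ioi_orbit [CompleteSpace X] {x : X}
    (hint : IntegrableOn (fun t => T t x) (Ioi 0)) :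
    HasGeneratorValue T (∫ t in Ioi 0, T t x) (-x) := by
  have hcont : ContinuousWithinAt (fun t => T t x) (Ioi 0) 0 :=
    (hT.continuousOn x 0 self_mem_Ici).mono Ioi_subset_Ici_self
  have hderiv : HasDerivWithinAt (fun u => ∫ t in (0 : ℝ)..u, T t x) (T 0 x) (Ioi 0) 0 :=
    (intervalIntegral.integral_hasDerivWithinAt_right (s := Ici 0) IntervalIntegrable.refl
      (((hT.continuousOn x).mono Ioi_subset_Ici_self).stronglyMeasurableAtFilter_nhdsWithin
        measurableSet_Ioi 0) hcont).mono Ioi_subset_Ici_self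
  rw [hasDerivWithinAt_iff_tendsto_slope' self_notMem_Ioi, hT.map_zero] at hderiv
  refine hderiv.neg.congr' ?_
  filter_upwards [self_mem_nhdsWithin] with h hh
  have hsplit := intervalIntegral.integral_interval_add_Ioi hint
    (hint.mono_set (Ioi_subset_Ioi (le_of_lt hh)))
  rw [hT.apply_integral_Ioi_orbit hint (le_of_lt hh), ← hsplit, slope_def_module,
    intervalIntegral.integral_same, sub_zero, sub_zero, ← smul_neg, sub_add_cancel_right]

end IsC0Semigroup

theorem ExponentiallyStable.exists_integrableOn_opNorm_le (hs : ExponentiallyStable T) :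
    ∃ g : ℝ → ℝ, IntegrableOn g (Ioi 0) ∧ ∀ t ∈ Ioi 0, ‖T t‖ ≤ g t := by
  obtain ⟨M, ε, -, hε, hM⟩ := hs
  refine ⟨fun t => M * Real.exp (-ε * t), (exp_neg_integrableOn_Ioi 0 hε).const_mul M,
    fun t ht => ?_⟩
  simpa only [neg_mul] using hM t (le_of_lt ht)

theorem ExponentiallyStable.exists_norm_integral_orbit_le
    (hs : ExponentiallyStable T) : ∃ C : ℝ, ∀ x, ‖∫ t in Ioi 0, T t x‖ ≤ C * ‖x‖ := by
  obtain ⟨g, hg, hTg⟩ := hs.exists_integrableOn_opNorm_le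
  refine ⟨∫ t in Ioi 0, g t, fun x => ?_⟩
  rw [← integral_mul_const]
  refine norm_integral_le_of_norm_le (hg.mul_const ‖x‖) ?_
  filter_upwards [ae_restrict_mem measurableSet_Ioi] with t ht
  exact (T t).le_of_opNorm_le (hTg t ht) x

namespace IsC0Semigroup

theorem integrableOn_orbit (hT : IsC0Semigroup T) (hs : ExponentiallyStable T) (x : X) :
    IntegrableOn (fun t => T t x) (Ioi 0) := by
  obtain ⟨g, hg, hTg⟩ := hs.exists_integrableOn_opNorm_le
  refine Integrable.mono' (hg.mul_const ‖x‖)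
    (((hT.continuousOn x).mono Ioi_subset_Ici_self).aestronglyMeasurable measurableSet_Ioi) ?_
  filter_upwards [ae_restrict_mem measurableSet_Ioi] with t ht
  exact (T t).le_of_opNorm_le (hTg t ht) x

/-- The potential operator `∫₀^∞ T t dt` of an exponentially stable semigroup, with the integral
taken pointwise, since `t ↦ T t` need not be measurable in the operator norm. -/
noncomputable def potential (hT : IsC0Semigroup T) (hs : ExponentiallyStable T) : X →L[ℝ] X :=
  LinearMap.mkContinuousOfExistsBound
    { toFun := fun x => ∫ t in Ioi 0, T t x
      map_add' := fun x y => by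
        simpa using
          integral_add (hT.integrableOn_orbit hs x) (hT.integrableOn_orbit hs y)
      map_smul' := fun c x => by
        simpa using integral_smul c fun t => T t x }
    hs.exists_norm_integral_orbit_le

theorem potential_apply (hT : IsC0Semigroup T) (hs : ExponentiallyStable T) (x : X) :
    hT.potential hs x = ∫ t in Ioi 0, T t x :=
  rfl

variable [CompleteSpace X]

theorem potential_apply_orbit (hT : IsC0Semigroup T) (hs : ExponentiallyStable T) {t : ℝ}
    (ht : 0 ≤ t) (x : X) : hT.potential hs (T t x) = T t (hT.potential hs x) := by
  rw [potential_apply, potential_apply, ← (T t).integral_comp_comm (hT.integrableOn_orbit hs x)]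
  refine setIntegral_congr_fun measurableSet_Ioi fun s hs => ?_
  rw [← hT.map_add_apply ht (le_of_lt hs), ← hT.map_add_apply (le_of_lt hs) ht, add_comm]

theorem isBoundedInverse_neg_potential (hT : IsC0Semigroup T) (hs : ExponentiallyStable T) :
    IsBoundedInverse (generator T) (-hT.potential hs) := by
  set Q := hT.potential hs
  have hQ : ∀ x, HasGeneratorValue T (Q x) (-x) := fun x =>
    hT.hasGeneratorValue_integral_Ioi_orbit (hT.integrableOn_orbit hs x)
  have hright : ∀ x, HasGeneratorValue T ((-Q) x) x := fun x => by
    simpa using (hQ x).smul (-1)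
  refine ⟨fun y => ⟨⟨y, hright y⟩, (hasGeneratorValue_generator T ⟨_, _⟩).unique (hright y)⟩,
    fun x => ?_⟩
  have hQA : HasGeneratorValue T (Q x) (Q (generator T x)) := by
    refine ((Q.continuous.tendsto _).comp (hasGeneratorValue_generator T x)).congr' ?_
    filter_upwards [self_mem_nhdsWithin] with t ht
    rw [Function.comp_apply, map_smul, map_sub, hT.potential_apply_orbit hs (le_of_lt ht)]
  rw [neg_apply, hQA.unique (hQ x), neg_neg]

end IsC0Semigroup

end Semigroup

section PositiveSemigroup

variable {X : Type*} [NormedAddCommGroup X] [NormedSpace ℝ X] [PartialOrder X]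
  {T : ℝ → X →L[ℝ] X}

theorem IsPositiveFunctional.setLIntegral_orbit_lt_top_iff [CompleteSpace X]
    {φ : X →L[ℝ] ℝ} (hφ : IsPositiveFunctional φ) (hT : IsC0Semigroup T)
    (hpos : IsPositiveSemigroup T) {x : X} (hx : 0 ≤ x) :
    ∫⁻ t in Ici (0 : ℝ), ENNReal.ofReal (φ (T t x)) < ⊤ ↔
      BddAbove (φ '' ((fun b => ∫ t in 0..b, T t x) '' Ici 0)) := by
  have hcont : ContinuousOn (fun t => φ (T t x)) (Ici 0) :=
    φ.continuous.comp_continuousOn (hT.continuousOn x)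
  rw [setLIntegral_ofReal_lt_top_iff_bddAbove_integral
    (hcont.locallyIntegrableOn measurableSet_Ici) fun t ht => hφ _ (hpos t ht x hx), image_image]
  refine iff_of_eq (congrArg BddAbove (image_congr fun b hb => ?_))
  exact φ.intervalIntegral_comp_comm (hT.intervalIntegrable_orbit x le_rfl hb)

variable [IsOrderedAddMonoid X]

namespace IsPositiveSemigroup

variable (hpos : IsPositiveSemigroup T)
include hpos

theorem monotone {t : ℝ} (ht : 0 ≤ t) : Monotone (T t) := fun x y hxy => by
  simpa only [map_sub, sub_nonneg] using hpos t ht _ (sub_nonneg.2 hxy)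

theorem integral_orbit_le_of_generatorValue [CompleteSpace X] (hT : IsC0Semigroup T) {x y : X}
    (hx : 0 ≤ x) (hxy : HasGeneratorValue T x (-y)) {t : ℝ} (ht : 0 ≤ t) :
    ∫ s in 0..t, T s y ≤ x := by
  have hFTC := hT.integral_orbit_generatorValue hxy ht
  simp only [map_neg, intervalIntegral.integral_neg] at hFTC
  rw [← neg_neg (∫ s in 0..t, T s y), hFTC, neg_sub]
  exact sub_le_self x (hpos t ht x hx)

end IsPositiveSemigroup

theorem IsL1NormDetector.weaklyL1StableOnCone [CompleteSpace X] {x z : X}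
    (hz : IsL1NormDetector T z) (hT : IsC0Semigroup T) (hpos : IsPositiveSemigroup T)
    (hx : 0 ≤ x) (hxz : HasGeneratorValue T x (-z)) : WeaklyL1StableOnCone T := by
  intro φ hφ y _
  refine setLIntegral_functional_orbit_lt_top (hz.2 φ hφ ?_) y
  rw [hφ.setLIntegral_orbit_lt_top_iff hT hpos hz.1]
  exact hφ.monotone.map_bddAbove ⟨x, forall_mem_image.2 fun b hb =>
    hpos.integral_orbit_le_of_generatorValue hT hx hxz hb⟩

variable [IsOrderedModule ℝ X]

namespace IsPositiveSemigroup

variable [OrderClosedTopology X] (hpos : IsPositiveSemigroup T)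
include hpos

theorem potential_nonneg (hT : IsC0Semigroup T) (hs : ExponentiallyStable T) {x : X} (hx : 0 ≤ x) :
    0 ≤ hT.potential hs x :=
  integral_nonneg_of_ae <| (ae_restrict_mem measurableSet_Ioi).mono fun t ht =>
    hpos t (le_of_lt ht) x hx

variable (hT : IsC0Semigroup T)
include hT

theorem integral_orbit_mono_interval {x : X} (hx : 0 ≤ x) {a b c : ℝ} (ha : 0 ≤ a)
    (hab : a ≤ b) (hbc : b ≤ c) : ∫ t in b..c, T t x ≤ ∫ t in a..c, T t x := by
  rw [intervalIntegral.integral_of_le hbc, intervalIntegral.integral_of_le (hab.trans hbc)]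
  refine setIntegral_mono_set (hT.intervalIntegrable_orbit x ha (hab.trans hbc)).1 ?_
    (Ioc_subset_Ioc_left hab).eventuallyLE
  filter_upwards [ae_restrict_mem measurableSet_Ioc] with t ht
  exact hpos t (ha.trans ht.1.le) x hx

variable [CompleteSpace X]

theorem smul_orbit_le_integral_orbit {x y : X} {a b : ℝ} (ha : 0 ≤ a) (hab : a ≤ b)
    (hxy : ∀ r ∈ Icc 0 (b - a), T r x ≤ y) : (b - a) • T b x ≤ ∫ s in a..b, T s y := by
  rw [← intervalIntegral.integral_const, intervalIntegral.integral_of_le hab,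
    intervalIntegral.integral_of_le hab]
  refine setIntegral_mono_on intervalIntegrable_const.1
    (hT.intervalIntegrable_orbit y ha hab).1 measurableSet_Ioc fun s hs => ?_
  have hs₀ : 0 ≤ s := ha.trans hs.1.le
  have hbs : 0 ≤ b - s := sub_nonneg.2 hs.2
  calc T b x = T s (T (b - s) x) := by rw [← hT.map_add_apply hs₀ hbs, add_sub_cancel]
    _ ≤ T s y := hpos.monotone hs₀ (hxy _ ⟨hbs, sub_le_sub_left hs.1.le b⟩)

variable {e : X} {K C : ℝ} (he : 0 ≤ e) (hK₀ : 0 ≤ K) (hK : ∀ t ∈ Icc 0 1, T t e ≤ K • e)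
  (hC : ∀ b, 0 ≤ b → ∫ t in 0..b, T t e ≤ C • e)
include he hK₀ hK hC

theorem orbit_add_one_le_smul {t : ℝ} (ht : 0 ≤ t) : T (t + 1) e ≤ (K * C) • e := calc
  T (t + 1) e = (t + 1 - t) • T (t + 1) e := by rw [add_sub_cancel_left, one_smul]
  _ ≤ ∫ s in t..t + 1, T s (K • e) :=
    hpos.smul_orbit_le_integral_orbit hT ht (by linarith) (by rwa [add_sub_cancel_left])
  _ = K • ∫ s in t..t + 1, T s e := by simp only [map_smul, intervalIntegral.integral_smul]
  _ ≤ K • ∫ s in 0..t + 1, T s e := smul_le_smul_of_nonneg_left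
    (hpos.integral_orbit_mono_interval hT he le_rfl ht (by linarith)) hK₀
  _ ≤ K • C • e := smul_le_smul_of_nonneg_left (hC _ (by linarith)) hK₀
  _ = (K * C) • e := smul_smul K C e

theorem smul_orbit_add_one_le_smul (hC₀ : 0 ≤ C) {t : ℝ} (ht : 0 ≤ t) :
    t • T (t + 1) e ≤ (K * C * C) • e := calc
  t • T (t + 1) e = (t - 0) • T t (T 1 e) := by
    rw [sub_zero, hT.map_add_apply ht zero_le_one]
  _ ≤ ∫ s in 0..t, T s ((K * C) • e) :=
    hpos.smul_orbit_le_integral_orbit hT le_rfl ht fun r hr => by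
      rw [← hT.map_add_apply hr.1 zero_le_one]
      exact hpos.orbit_add_one_le_smul hT he hK₀ hK hC hr.1
  _ = (K * C) • ∫ s in 0..t, T s e := by
    simp only [map_smul, intervalIntegral.integral_smul]
  _ ≤ (K * C) • C • e := smul_le_smul_of_nonneg_left (hC t ht) (by positivity)
  _ = (K * C * C) • e := smul_smul _ _ _

end IsPositiveSemigroup

theorem WeaklyL1StableOnCone.bddAbove_integral_orbit (hw : WeaklyL1StableOnCone T) {e : X}
    (hX : IsOrderUnitSpace e) (hT : IsC0Semigroup T) (hpos : IsPositiveSemigroup T) {x : X}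
    (hx : 0 ≤ x) : BddAbove ((fun b => ∫ t in 0..b, T t x) '' Ici 0) := by
  have := hX.complete
  have := hX.orderClosedTopology
  refine hX.bddAbove_of_forall_bddAbove_image (forall_mem_image.2 fun b hb => ?_) fun φ hφ =>
    (hφ.setLIntegral_orbit_lt_top_iff hT hpos hx).1 (hw φ hφ x hx)
  rw [intervalIntegral.integral_of_le hb]
  exact integral_nonneg_of_ae <| (ae_restrict_mem measurableSet_Ioc).mono fun t ht =>
    hpos t ht.1.le x hx

theorem WeaklyL1StableOnCone.exponentiallyStable (hw : WeaklyL1StableOnCone T) {e : X}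
    (hX : IsOrderUnitSpace e) (hT : IsC0Semigroup T) (hpos : IsPositiveSemigroup T) :
    ExponentiallyStable T := by
  have := hX.complete
  have := hX.orderClosedTopology
  have he : 0 ≤ e := hX.isOrderUnit.1
  obtain ⟨u, hu⟩ := hw.bddAbove_integral_orbit hX hT hpos he
  have hC : ∀ b, 0 ≤ b → ∫ t in 0..b, T t e ≤ ‖u‖ • e := fun b hb =>
    (hu (mem_image_of_mem _ hb)).trans (hX.le_smul_of_norm_le le_rfl)
  obtain ⟨K, hK⟩ := hT.exists_opNorm_le_on_Icc 1
  have hK₀ : 0 ≤ K := (norm_nonneg _).trans (hK 0 ⟨le_rfl, zero_le_one⟩)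
  have hKe : ∀ t ∈ Icc 0 1, T t e ≤ (K * ‖e‖) • e := fun t ht =>
    hX.le_smul_of_norm_le ((T t).le_of_opNorm_le (hK t ht) e)
  set M := K * ‖e‖ * ‖u‖ * ‖u‖
  have hM : 0 ≤ M := by positivity
  set t := 2 * M + 1
  have ht : 0 < t := by positivity
  have hdecay : T (t + 1) e ≤ (M / t) • e := by
    rw [div_eq_inv_mul, mul_smul, le_inv_smul_iff_of_pos ht]
    exact hpos.smul_orbit_add_one_le_smul hT he (by positivity) hKe hC (norm_nonneg u) ht.le
  refine hT.exponentiallyStable_of_opNorm_lt_one (t₀ := t + 1) (by positivity) ?_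
  calc ‖T (t + 1)‖ ≤ M / t :=
        hX.opNorm_le_of_apply_le hX (hpos.monotone (by positivity)) (by positivity) hdecay
    _ < 1 := (div_lt_one ht).2 (by simp only [t]; linarith)

end PositiveSemigroup

end PositiveSemigroup

theorem mainTheorem10 {X : Type*} [NormedAddCommGroup X] [NormedSpace ℝ X]
    [PartialOrder X] [IsOrderedAddMonoid X] [IsOrderedModule ℝ X]
    (e : X) (hX : PositiveSemigroup.IsOrderUnitSpace e)
    (T : ℝ → X →L[ℝ] X) (hT : PositiveSemigroup.IsC0Semigroup T)
    (hpos : PositiveSemigroup.IsPositiveSemigroup T)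
    (z : X) (hz : PositiveSemigroup.IsL1NormDetector T z) :
    List.TFAE [
      ∃ x : (PositiveSemigroup.generator T).domain,
        0 ≤ (x : X) ∧ PositiveSemigroup.generator T x = -z,
      PositiveSemigroup.WeaklyL1StableOnCone T,
      PositiveSemigroup.ExponentiallyStable T,
      ∃ R : X →L[ℝ] X, PositiveSemigroup.IsBoundedInverse (PositiveSemigroup.generator T) R ∧
        ∀ x : X, 0 ≤ x → 0 ≤ -(R x)] := by
  have := hX.complete
  have := hX.orderClosedTopology
  tfae_have 1 → 2 := by
    rintro ⟨x, hx, hxz⟩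
    exact hz.weaklyL1StableOnCone hT hpos hx
      (hxz ▸ PositiveSemigroup.hasGeneratorValue_generator T x)
  tfae_have 2 → 3 := fun hw => hw.exponentiallyStable hX hT hpos
  tfae_have 3 → 4 := fun hs => ⟨-hT.potential hs, hT.isBoundedInverse_neg_potential hs,
    fun x hx => by simpa only [neg_apply, neg_neg] using hpos.potential_nonneg hT hs hx⟩
  tfae_have 4 → 1 := by
    rintro ⟨R, ⟨hR, -⟩, hRpos⟩
    obtain ⟨hdom, hval⟩ := hR (-z)
    exact ⟨⟨R (-z), hdom⟩, by simpa only [map_neg] using hRpos z hz.1, hval⟩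
  tfae_finish
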